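/- Let $G$ be a finite abelian group, $H\subset G$ a subgroup of exponent $e$, $K_0$ a field containing a primitive $e$-th root of unity, and $K$ a $G/H$-Galois algebra over $K_0$, i.e. a nonzero commutative $K_0$-algebra with an action of $G/H$ by $K_0$-algebra automorphisms such that $K\otimes_{K_0}K\to\prod_{\gamma\in G/H}K$, $x\otimes y\mapsto (x\cdot{}^{\gamma}y)_\gamma$, is bijective. Let $G$ act on $K^\times$ and, entrywise, on $GL_n(K)$ through $G/H$; let $H$ act trivially on $K_0^\times$ and $GL_n(K_0)$. For a group $A$ with an action of a group $\Gamma$, let $H^1(\Gamma,A)$ denote the (non-abelian) cohomology set of maps $c\colon \Gamma\to A$ with $c(gg')=c(g)\,{}^{g}c(g')$, modulo $c\sim c'$ if there is an $a\in A$ with $c'(g)=a^{-1}c(g)\,{}^{g}a$ for all $g$. Assume that the homomorphism $$H^1(G,K^\times)\to H^1(H,K^\times)^{G/H}=H^1(H,K_0^\times)$$ of the Hochschild–Serre spectral sequence (restriction to $H$) is surjective. Then for every positive integer $n$ there is a unique bijective map $$\Phi\colon H^1(G,GL_n(K))\to H^1(H,GL_n(K_0))$$ that is compatible with restriction $\mathrm{res}\colon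 H^1(G,GL_n(K))\to H^1(H,GL_n(K))$ and extension of scalars $\mathrm{ext}\colon H^1(H,GL_n(K_0))\to H^1(H,GL_n(K))$, i.e. such that $\mathrm{ext}\circ\Phi=\mathrm{res}$. -/

import Mathlib

open scoped TensorProduct

/-! ## Non-abelian cohomology in degree one -/

/-- A `1`-cocycle of a group `G` with values in a (not necessarily abelian) group `A` on which `G`
acts through `ρ`: a map `c : G → A` with `c (g g') = c g · ᵍ(c g')`. -/
structure OneCocycle {G A : Type*} [Group G] [Group A] (ρ : G →* MulAut A) where
  /-- the underlying map -/
  toFun : G → A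
  map_mul' : ∀ g g' : G, toFun (g * g') = toFun g * ρ g (toFun g')

/-- Two cocycles `c`, `c'` are cohomologous if `c' g = a⁻¹ · c g · ᵍa` for some `a`. -/
def OneCocycle.setoid {G A : Type*} [Group G] [Group A] (ρ : G →* MulAut A) :
    Setoid (OneCocycle ρ) where
  r c c' := ∃ a : A, ∀ g : G, c'.toFun g = a⁻¹ * c.toFun g * ρ g a
  iseqv :=
    { refl := fun c => ⟨1, fun g => by simp⟩
      symm := by
        rintro c c' ⟨a, ha⟩
        exact ⟨a⁻¹, fun g => by rw [ha g]; simp [mul_assoc]⟩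
      trans := by
        rintro c c' c'' ⟨a, ha⟩ ⟨b, hb⟩
        exact ⟨a * b, fun g => by rw [hb g, ha g]; simp [mul_assoc]⟩ }

/-- The non-abelian cohomology set `H¹(G, A)`, where `G` acts on `A` through `ρ`. -/
def NonabH1 {G A : Type*} [Group G] [Group A] (ρ : G →* MulAut A) : Type _ :=
  Quotient (OneCocycle.setoid ρ)

/-- Pull back a cocycle along `φ : G' → G` and push it forward along the equivariant
homomorphism `f : A → A'`. -/
def OneCocycle.map {G A G' A' : Type*} [Group G] [Group A] [Group G'] [Group A']
    {ρ : G →* MulAut A} {ρ' : G' →* MulAut A'} (φ : G' →* G) (f : A →* A')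
    (hf : ∀ (g : G') (a : A), f (ρ (φ g) a) = ρ' g (f a)) (c : OneCocycle ρ) :
    OneCocycle ρ' where
  toFun g := f (c.toFun (φ g))
  map_mul' g g' := by rw [map_mul, c.map_mul', map_mul, hf]

/-- The functoriality of `H¹(G, A)` in the pair `(G, A)`. -/
def NonabH1.map {G A G' A' : Type*} [Group G] [Group A] [Group G'] [Group A']
    {ρ : G →* MulAut A} {ρ' : G' →* MulAut A'} (φ : G' →* G) (f : A →* A')
    (hf : ∀ (g : G') (a : A), f (ρ (φ g) a) = ρ' g (f a)) : NonabH1 ρ → NonabH1 ρ' :=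
  Quotient.map (OneCocycle.map φ f hf) (by
    rintro c c' ⟨a, ha⟩
    refine ⟨f a, fun g => ?_⟩
    change f (c'.toFun (φ g)) = (f a)⁻¹ * f (c.toFun (φ g)) * ρ' g (f a)
    rw [ha (φ g), map_mul, map_mul, map_inv, hf])

/-- The restriction map `H¹(G, A) → H¹(H, A)` to a subgroup. -/
def NonabH1.res {G A : Type*} [Group G] [Group A] (ρ : G →* MulAut A) (H : Subgroup G) :
    NonabH1 ρ → NonabH1 (ρ.comp H.subtype) :=
  NonabH1.map H.subtype (MonoidHom.id A) (fun _ _ => rfl)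

/-! ## Actions on units and on general linear groups -/

/-- Ring automorphisms of `R` act on the unit group of `R`. -/
def unitsAut (R : Type*) [CommRing R] : RingAut R →* MulAut Rˣ where
  toFun σ := Units.mapEquiv σ.toMulEquiv
  map_one' := rfl
  map_mul' _ _ := rfl

/-- Ring automorphisms of `R` act entrywise on `GL_n(R)`. -/
def glAut (n : ℕ) (R : Type*) [CommRing R] : RingAut R →* MulAut (GL (Fin n) R) where
  toFun σ := Units.mapEquiv σ.mapMatrix.toMulEquiv
  map_one' := rfl
  map_mul' _ _ := rfl

section Actions

variable {G : Type*} [CommGroup G] (H : Subgroup G) (K : Type*) [CommRing K]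
  [MulSemiringAction (G ⧸ H) K]

/-- If `G/H` acts on `K`, then `G` acts on `K` through the quotient map. -/
def inflAction : G →* RingAut K :=
  (MulSemiringAction.toRingAut (G ⧸ H) K).comp (QuotientGroup.mk' H)

/-- The action of `G` on `Kˣ`. -/
def unitsAction : G →* MulAut Kˣ := (unitsAut K).comp (inflAction H K)

/-- The action of `G` on `GL_n(K)`. -/
def glAction (n : ℕ) : G →* MulAut (GL (Fin n) K) := (glAut n K).comp (inflAction H K)

variable {H} in
theorem inflAction_eq_one (h : H) : inflAction H K h = 1 := by
  have : (QuotientGroup.mk' H) (h : G) = 1 := (QuotientGroup.eq_one_iff (h : G)).2 h.2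
  rw [inflAction, MonoidHom.comp_apply, this, map_one]

variable (K₀ : Type*) [Field K₀] [Algebra K₀ K]

/-- Extension of scalars `H¹(H, K₀ˣ) → H¹(H, Kˣ)`; here `H` acts trivially on `K₀ˣ`. -/
def extScalarsUnits :
    NonabH1 (1 : H →* MulAut K₀ˣ) → NonabH1 ((unitsAction H K).comp H.subtype) :=
  NonabH1.map (MonoidHom.id H) (Units.map (algebraMap K₀ K : K₀ →* K)) (fun h a => by
    have : (unitsAction H K).comp H.subtype h = 1 := by
      simp [unitsAction, inflAction_eq_one]
    rw [this]; rfl)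

/-- Extension of scalars `H¹(H, GL_n(K₀)) → H¹(H, GL_n(K))`; here `H` acts trivially
on `GL_n(K₀)`. -/
def extScalarsGL (n : ℕ) :
    NonabH1 (1 : H →* MulAut (GL (Fin n) K₀)) → NonabH1 ((glAction H K n).comp H.subtype) :=
  NonabH1.map (MonoidHom.id H) (Matrix.GeneralLinearGroup.map (algebraMap K₀ K)) (fun h a => by
    have : (glAction H K n).comp H.subtype h = 1 := by
      simp [glAction, inflAction_eq_one]
    rw [this]; rfl)

end Actions

/-! ## Galois algebras -/

section Galois

variable (K₀ K Γ : Type*) [Field K₀] [CommRing K] [Algebra K₀ K] [Group Γ]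
  [MulSemiringAction Γ K] [SMulCommClass Γ K₀ K]

/-- The map `K ⊗ K → ∏_{γ ∈ Γ} K`, `x ⊗ y ↦ (x · ᵞy)_γ`. -/
noncomputable def galoisMap : K ⊗[K₀] K →ₗ[K₀] (Γ → K) :=
  LinearMap.pi fun γ =>
    LinearMap.mul' K₀ K ∘ₗ TensorProduct.map LinearMap.id (DistribSMul.toLinearMap K₀ K γ)

/-- A commutative algebra `K` over a field `K₀`, with an action of the finite group `Γ` by
`K₀`-algebra automorphisms, is a `Γ`-Galois algebra if `Spec K` is a `Γ`-torsor over `Spec K₀`: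
`K` is nonzero and `K ⊗ K → ∏_{γ ∈ Γ} K` is bijective. -/
structure IsGaloisAlgebra [Finite Γ] : Prop where
  nontrivial : Nontrivial K
  bijective : Function.Bijective (galoisMap K₀ K Γ)

variable {K₀ K Γ} in
theorem galoisMap_tmul (x y : K) (γ : Γ) : galoisMap K₀ K Γ (x ⊗ₜ y) γ = x * γ • y := rfl

variable {K₀ K Γ} in
/-- The invariants of a Galois algebra are the scalars. -/
theorem IsGaloisAlgebra.exists_algebraMap_eq [Finite Γ] (hK : IsGaloisAlgebra K₀ K Γ) {x : K}
    (hx : ∀ γ : Γ, γ • x = x) : ∃ y : K₀, algebraMap K₀ K y = x := by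
  have := hK.nontrivial
  have h1 : (1 : K) ⊗ₜ[K₀] x = x ⊗ₜ[K₀] (1 : K) := hK.bijective.1 (by
    funext γ
    rw [galoisMap_tmul, galoisMap_tmul, hx, smul_one, one_mul, mul_one])
  obtain ⟨f, hf⟩ := LinearMap.exists_leftInverse_of_injective (Algebra.linearMap K₀ K)
    (LinearMap.ker_eq_bot.2 (algebraMap K₀ K).injective)
  have hf1 : f 1 = 1 := by
    simpa using LinearMap.congr_fun hf (1 : K₀)
  have h2 := congrArg (fun z => TensorProduct.lid K₀ K (TensorProduct.map f LinearMap.id z)) h1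
  simp only [TensorProduct.map_tmul, TensorProduct.lid_tmul, hf1, one_smul, LinearMap.id_apply]
    at h2
  exact ⟨f x, by rw [Algebra.algebraMap_eq_smul_one, ← h2]⟩

end Galois

/-! ## The Hochschild–Serre homomorphism -/

section HochschildSerre

variable {G : Type*} [CommGroup G] [Finite G] {H : Subgroup G} {K₀ K : Type*} [Field K₀]
  [CommRing K] [Algebra K₀ K] [MulSemiringAction (G ⧸ H) K] [SMulCommClass (G ⧸ H) K₀ K]

/-- The restriction to `H` of a class in `H¹(G, Kˣ)` comes from a unique class in
`H¹(H, K₀ˣ)`. -/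
theorem existsUnique_extScalarsUnits_eq_res (hK : IsGaloisAlgebra K₀ K (G ⧸ H))
    (x : NonabH1 (unitsAction H K)) :
    ∃! y : NonabH1 (1 : H →* MulAut K₀ˣ),
      extScalarsUnits H K K₀ y = NonabH1.res (unitsAction H K) H x := by
  have := hK.nontrivial
  have hinj : Function.Injective (Units.map (algebraMap K₀ K : K₀ →* K)) :=
    Units.map_injective (algebraMap K₀ K).injective
  have htriv : ∀ h : H, unitsAction H K h = 1 := fun h => by
    simp [unitsAction, inflAction_eq_one]
  induction x using Quotient.inductionOn with | h c => ?_
  have hfix : ∀ (h : H) (γ : G ⧸ H), γ • (c.toFun h : K) = (c.toFun h : K) := by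
    intro h γ
    obtain ⟨g, rfl⟩ := QuotientGroup.mk_surjective γ
    have h1 := c.map_mul' g h
    rw [mul_comm g (h : G), c.map_mul', htriv, MulAut.one_apply, mul_comm, mul_right_inj] at h1
    exact (congrArg Units.val h1).symm
  have hex : ∀ h : H, ∃ u : K₀ˣ, Units.map (algebraMap K₀ K : K₀ →* K) u = c.toFun h := by
    intro h
    obtain ⟨y, hy⟩ := hK.exists_algebraMap_eq (hfix h)
    have hy0 : y ≠ 0 := by
      rintro rfl
      exact (c.toFun h).ne_zero (by rw [← hy, map_zero])
    exact ⟨Units.mk0 y hy0, Units.ext hy⟩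
  choose u hu using hex
  refine ⟨Quotient.mk _ ⟨u, fun h h' => hinj ?_⟩, ?_, ?_⟩
  · rw [hu, MonoidHom.one_apply, MulAut.one_apply, map_mul, hu, hu, Subgroup.coe_mul, c.map_mul',
      htriv, MulAut.one_apply]
  · refine Quotient.sound ⟨1, fun h => ?_⟩
    change c.toFun h = 1⁻¹ * Units.map (algebraMap K₀ K : K₀ →* K) (u h) * _
    rw [hu, map_one, inv_one, one_mul, mul_one]
  · intro y hy
    induction y using Quotient.inductionOn with | h d => ?_
    obtain ⟨a, ha⟩ := Quotient.exact hy
    refine Quotient.sound ⟨1, fun h => hinj ?_⟩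
    have h1 : c.toFun h = a⁻¹ * Units.map (algebraMap K₀ K : K₀ →* K) (d.toFun h) *
        unitsAction H K h a := ha h
    rw [htriv, MulAut.one_apply, mul_comm, mul_inv_cancel_left] at h1
    change Units.map (algebraMap K₀ K : K₀ →* K) (u h) =
      Units.map (algebraMap K₀ K : K₀ →* K) (1⁻¹ * d.toFun h * 1)
    rw [hu, inv_one, one_mul, mul_one, h1]

/-- The homomorphism `H¹(G, Kˣ) → H¹(H, Kˣ)^{G/H} = H¹(H, K₀ˣ)` of the Hochschild–Serre spectral
sequence: restriction to `H`, followed by the inverse of extension of scalars. -/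
noncomputable def hochschildSerreMap (hK : IsGaloisAlgebra K₀ K (G ⧸ H)) :
    NonabH1 (unitsAction H K) → NonabH1 (1 : H →* MulAut K₀ˣ) :=
  fun x => (existsUnique_extScalarsUnits_eq_res hK x).choose

end HochschildSerre

/-!
A cocycle `c` of `G` in `GL_n(K)` is the same as a semilinear action `v ↦ c(g) · ᵍv` of `G` on `Kⁿ`.
By the surjectivity hypothesis every character `χ : H → K₀ˣ` extends to a cocycle `a_χ : G → Kˣ`
(`exists_oneCocycle_restrict_eq`). The `K₀`-subspaces `W_χ = {v | c(g) · ᵍv = a_χ(g) v}` satisfy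
`Kⁿ = ⨁_χ K ⊗ W_χ`: this combines the decomposition of `Kⁿ` into isotypic components under `H` with
Galois descent for each component twisted by `a_χ⁻¹`. Both are done in one step by the twisted sums
`∑_g a_χ(g)⁻¹ c(g) · ᵍv`, which lie in `W_χ`; orthogonality of characters and the separating
elements of the Galois algebra give spanning (`span_semilinearEigenspace`) and independence
(`linearIndependent_semilinearEigenspace`). A basis of `Kⁿ` made of eigenvectors shows that `c` is
cohomologous to `diag(a_{χ₁}, …, a_{χₙ})` (`exists_diagonalGL_eq`). The same statement with `G = H`
and `K = K₀` shows that every homomorphism `H → GL_n(K₀)` is conjugate to `diag(χ₁, …, χₙ)`.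

Restriction takes `diag(a_{χᵢ})` to `diag(χᵢ)`. Two such diagonal representations of `H` that are
conjugate over `K` have the same characters up to a permutation
(`exists_perm_of_diagonalGL_conj`), and permuting the characters changes neither the class over `K₀`
nor the class of the cocycle of `G`. Hence both cohomology sets are in bijection with multisets of
`n` characters of `H`, compatibly with `res` and `ext`, and `ext` is injective, whence uniqueness.
-/

/-! ### Semilinear actions and their eigenspaces -/

section Descent

variable {G N K₀ K V : Type*} [Group G] [CommGroup N] [Field K₀] [CommRing K] [Algebra K₀ K]

/-- A group `G` acting on a `K₀`-algebra `K` through `σ` makes `K` Galois over `K₀` modulo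
`j : N → G` if `j` is injective, `N` acts trivially, the invariants are the scalars, and the action
of `G / j(N)` admits separating elements: a finite set of pairs `(x, y)` for which `∑ x · ᵍy`, as a
function of `g`, is the indicator function of `j(N)`. No quotient group appears, so that the case
`K = K₀`, `j = id` is covered on the same footing as a `G/H`-Galois algebra. -/
structure IsGaloisModulo (σ : G →* (K ≃ₐ[K₀] K)) (j : N →* G) : Prop where
  injective : Function.Injective j
  map_eq_one : ∀ h, σ (j h) = 1
  exists_algebraMap_eq : ∀ x : K, (∀ g, σ g x = x) → ∃ y : K₀, algebraMap K₀ K y = x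
  exists_separating : ∃ S : Finset (K × K), ∀ g : G,
    (g ∈ Set.range j → ∑ p ∈ S, p.1 * σ g p.2 = 1) ∧
    (g ∉ Set.range j → ∑ p ∈ S, p.1 * σ g p.2 = 0)

/-- `a` is a `1`-cocycle of `G` in `Kˣ` whose restriction to `N` is the character `χ`. -/
structure IsExtensionOf (σ : G →* (K ≃ₐ[K₀] K)) (j : N →* G) (χ : N →* K₀ˣ) (a : G → Kˣ) :
    Prop where
  map_mul : ∀ g g', (a (g * g') : K) = a g * σ g (a g')
  restrict : ∀ h, (a (j h) : K) = algebraMap K₀ K (χ h)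

theorem IsExtensionOf.map_mul_right {σ : G →* (K ≃ₐ[K₀] K)} {j : N →* G} {χ : N →* K₀ˣ}
    {a : G → Kˣ} (ha : IsExtensionOf σ j χ a) (g : G) (h : N) :
    a (g * j h) = a g * Units.map (algebraMap K₀ K : K₀ →* K) (χ h) := by
  ext
  simp [ha.map_mul, ha.restrict]

variable [AddCommGroup V] [Module K V]

/-- The average `∑_g a(g)⁻¹ · s(g) v`, not divided by the order of the group. -/
def twistedSum [Fintype G] (s : G →* AddMonoid.End V) (a : G → Kˣ) : V →+ V :=
  ∑ g, (DistribSMul.toAddMonoidHom V (((a g)⁻¹ : Kˣ) : K)).comp (s g)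

theorem twistedSum_apply [Fintype G] (s : G →* AddMonoid.End V) (a : G → Kˣ) (v : V) :
    twistedSum s a v = ∑ g, (((a g)⁻¹ : Kˣ) : K) • s g v := by
  simp only [twistedSum, AddMonoidHom.finsetSum_apply]
  rfl

variable {σ : G →* (K ≃ₐ[K₀] K)} {j : N →* G} {s : G →* AddMonoid.End V}

/-- A sum over `G` against the separating elements is a sum over `N`. -/
theorem sum_separating [Fintype G] [Fintype N] (hσ : IsGaloisModulo σ j) {S : Finset (K × K)}
    (hS : ∀ g : G, (g ∈ Set.range j → ∑ p ∈ S, p.1 * σ g p.2 = 1) ∧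
      (g ∉ Set.range j → ∑ p ∈ S, p.1 * σ g p.2 = 0)) (f : G → V) :
    ∑ p ∈ S, p.1 • ∑ g, σ g p.2 • f g = ∑ h, f (j h) := by
  simp_rw [Finset.smul_sum, ← mul_smul]
  rw [Finset.sum_comm]
  simp_rw [← Finset.sum_smul]
  refine (Finset.sum_of_injOn j hσ.injective.injOn (fun _ _ => Finset.mem_univ _) ?_ ?_).symm
  · intro g _ hg
    rw [(hS g).2 (by simpa using hg), zero_smul]
  · intro h _
    rw [(hS _).1 ⟨h, rfl⟩, one_smul]

variable [Module K₀ V] [IsScalarTower K₀ K V]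

/-- The `K₀`-subspace of those `v` on which the semilinear action `s` is given by `a`,
i.e. `s g v = a g • v` for all `g`. -/
def semilinearEigenspace (σ : G →* (K ≃ₐ[K₀] K)) (s : G →* AddMonoid.End V)
    (hs : ∀ g (k : K) (v : V), s g (k • v) = σ g k • s g v) (a : G → Kˣ) : Submodule K₀ V where
  carrier := {v | ∀ g, s g v = (a g : K) • v}
  add_mem' hv hw g := by rw [map_add, hv g, hw g, smul_add]
  zero_mem' g := by simp
  smul_mem' t v hv g := by
    rw [← algebraMap_smul K t v, hs, hv g, AlgEquiv.commutes, smul_comm]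

theorem twistedSum_mem [Fintype G] (hs : ∀ g (k : K) (v : V), s g (k • v) = σ g k • s g v)
    {a : G → Kˣ} {χ : N →* K₀ˣ} (ha : IsExtensionOf σ j χ a) (v : V) :
    twistedSum s a v ∈ semilinearEigenspace σ s hs a := by
  intro g₀
  rw [twistedSum_apply, map_sum, Finset.smul_sum]
  refine Fintype.sum_equiv (Equiv.mulLeft g₀) _ _ fun g => ?_
  have h1 : σ g₀ (((a g)⁻¹ : Kˣ) : K) = (a g₀ : K) * (((a (g₀ * g))⁻¹ : Kˣ) : K) := by
    rw [Units.eq_mul_inv_iff_mul_eq, ha.map_mul, mul_left_comm, ← map_mul, Units.inv_mul, map_one,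
      mul_one]
  rw [hs, h1, Equiv.coe_mulLeft, mul_smul, map_mul]
  rfl

theorem twistedSum_smul [Fintype G] (hs : ∀ g (k : K) (v : V), s g (k • v) = σ g k • s g v)
    {a b : G → Kˣ} {v : V} (hv : v ∈ semilinearEigenspace σ s hs b) (k : K) :
    twistedSum s a (k • v) = (∑ g, (((a g)⁻¹ : Kˣ) : K) * b g * σ g k) • v := by
  rw [twistedSum_apply, Finset.sum_smul]
  refine Finset.sum_congr rfl fun g _ => ?_
  rw [hs, hv g, ← mul_smul, ← mul_smul]
  congr 1
  ring

/-- Distinct characters are orthogonal: replacing `g` by `g · j(h)` multiplies the sum by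
`χ(h)⁻¹ ψ(h)`. -/
theorem sum_inv_mul_mul_eq_zero [Fintype G] (hσ : IsGaloisModulo σ j) {χ ψ : N →* K₀ˣ}
    {a b : G → Kˣ} (ha : IsExtensionOf σ j χ a) (hb : IsExtensionOf σ j ψ b) (hne : χ ≠ ψ)
    (k : K) : ∑ g, (((a g)⁻¹ : Kˣ) : K) * b g * σ g k = 0 := by
  obtain ⟨h, hh⟩ := DFunLike.ne_iff.1 hne
  set S := ∑ g, (((a g)⁻¹ : Kˣ) : K) * b g * σ g k with hS
  have h1 : S = algebraMap K₀ K (((χ h)⁻¹ * ψ h : K₀ˣ) : K₀) * S := by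
    conv_lhs => rw [hS, ← Equiv.sum_comp (Equiv.mulRight (j h))]
    rw [hS, Finset.mul_sum]
    refine Finset.sum_congr rfl fun g _ => ?_
    rw [Equiv.coe_mulRight, ha.map_mul_right, hb.map_mul_right, map_mul, hσ.map_eq_one, mul_one,
      mul_inv, ← map_inv]
    simp only [Units.val_mul, Units.coe_map, MonoidHom.coe_coe, map_mul]
    ring
  have h2 : (((χ h)⁻¹ * ψ h : K₀ˣ) : K₀) - 1 ≠ 0 := by
    rw [sub_ne_zero, Ne, Units.val_eq_one, inv_mul_eq_one]
    exact hh
  have h3 : algebraMap K₀ K ((((χ h)⁻¹ * ψ h : K₀ˣ) : K₀) - 1) * S = 0 := by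
    rw [map_sub, map_one, sub_mul, one_mul, ← h1, sub_self]
  exact ((h2.isUnit.map (algebraMap K₀ K)).mul_right_eq_zero).1 h3

theorem IsGaloisModulo.exists_algebraMap_eq_sum [Fintype G] (hσ : IsGaloisModulo σ j) (k : K) :
    ∃ t : K₀, algebraMap K₀ K t = ∑ g, σ g k := by
  refine hσ.exists_algebraMap_eq _ fun g => ?_
  rw [map_sum]
  exact Fintype.sum_equiv (Equiv.mulLeft g) _ _ fun g' => by simp

/-- The trace form is nondegenerate, since the separating elements recover `|N| • k` from the traces
of the multiples of `k`. -/
theorem IsGaloisModulo.eq_zero_of_sum_eq_zero [Fintype G] [Fintype N] (hσ : IsGaloisModulo σ j)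
    (hN : (Fintype.card N : K₀) ≠ 0) {k : K} (hk : ∀ y, ∑ g, σ g (y * k) = 0) : k = 0 := by
  obtain ⟨S, hS⟩ := hσ.exists_separating
  have h1 := sum_separating hσ hS (fun g => σ g k)
  simp only [smul_eq_mul, ← map_mul, hk, mul_zero, Finset.sum_const_zero, hσ.map_eq_one,
    AlgEquiv.one_apply, Finset.sum_const, Finset.card_univ] at h1
  rw [nsmul_eq_mul, ← map_natCast (algebraMap K₀ K)] at h1
  exact ((hN.isUnit.map (algebraMap K₀ K)).mul_right_eq_zero).1 h1.symm

theorem sum_characters_eq_zero [Finite N] [Fintype (N →* K₀ˣ)]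
    [HasEnoughRootsOfUnity K₀ (Monoid.exponent N)] {h : N} (hh : h ≠ 1) :
    ∑ χ : N →* K₀ˣ, (((χ h)⁻¹ : K₀ˣ) : K₀) = 0 := by
  obtain ⟨φ, hφ⟩ := CommGroup.exists_apply_ne_one_of_hasEnoughRootsOfUnity N K₀ hh
  have h1 : ∑ χ : N →* K₀ˣ, (((χ h)⁻¹ : K₀ˣ) : K₀) =
      ((φ h)⁻¹ : K₀ˣ) * ∑ χ : N →* K₀ˣ, (((χ h)⁻¹ : K₀ˣ) : K₀) := by
    conv_lhs => rw [← Equiv.sum_comp (Equiv.mulLeft φ)]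
    simp [Finset.mul_sum, mul_comm]
  by_contra h2
  exact hφ (by simpa using (mul_eq_right₀ h2).1 h1.symm)

/-- A primitive root of order `e` forces `e ≠ 0` in `K₀`, and by Cauchy's theorem every prime
dividing the order of `N` divides its exponent `e`. -/
theorem card_ne_zero_of_hasEnoughRootsOfUnity [Fintype N]
    [HasEnoughRootsOfUnity K₀ (Monoid.exponent N)] : (Fintype.card N : K₀) ≠ 0 := by
  intro h0
  obtain ⟨ζ, hζ⟩ := HasEnoughRootsOfUnity.exists_primitiveRoot K₀ (Monoid.exponent N)
  have := hζ.neZero'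
  rcases CharP.char_is_prime_or_zero K₀ (ringChar K₀) with hp | hp
  · have := Fact.mk hp
    obtain ⟨g, hg⟩ := exists_prime_orderOf_dvd_card (ringChar K₀) ((ringChar.spec K₀ _).1 h0)
    exact NeZero.ne (Monoid.exponent N : K₀)
      ((ringChar.spec K₀ _).2 (hg ▸ Monoid.order_dvd_exponent g))
  · exact Fintype.card_ne_zero (zero_dvd_iff.1 (hp ▸ (ringChar.spec K₀ _).1 h0))

/-- The eigenspaces span: the separating elements and the orthogonality of characters write
`|N| • v` as a combination of twisted sums. -/
theorem span_semilinearEigenspace [Fintype G] [Finite N]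
    [HasEnoughRootsOfUnity K₀ (Monoid.exponent N)] (hσ : IsGaloisModulo σ j)
    (hs : ∀ g (k : K) (v : V), s g (k • v) = σ g k • s g v)
    {a : (N →* K₀ˣ) → G → Kˣ} (ha : ∀ χ, IsExtensionOf σ j χ (a χ)) :
    Submodule.span K (⋃ χ, (semilinearEigenspace σ s hs (a χ) : Set V)) = ⊤ := by
  have := Fintype.ofFinite N
  have := Fintype.ofFinite (N →* K₀ˣ)
  refine eq_top_iff.2 fun v _ => ?_
  obtain ⟨S, hS⟩ := hσ.exists_separating
  have h1 : ∑ χ, ∑ p ∈ S, p.1 • twistedSum s (a χ) (p.2 • v) = (Fintype.card N : K₀) • v := by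
    have h2 : ∀ χ, ∑ p ∈ S, p.1 • twistedSum s (a χ) (p.2 • v) =
        ∑ h, (((χ h)⁻¹ : K₀ˣ) : K₀) • s (j h) v := by
      intro χ
      have h3 := sum_separating hσ hS (fun g => ((((a χ) g)⁻¹ : Kˣ) : K) • s g v)
      simp_rw [twistedSum_apply, hs]
      simp_rw [smul_comm (σ _ _)] at h3
      rw [h3]
      refine Finset.sum_congr rfl fun h _ => ?_
      have h4 : a χ (j h) = Units.map (algebraMap K₀ K : K₀ →* K) (χ h) :=
        Units.ext ((ha χ).restrict h)
      rw [h4, ← map_inv, Units.coe_map, MonoidHom.coe_coe, algebraMap_smul]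
    simp_rw [h2]
    rw [Finset.sum_comm]
    simp_rw [← Finset.sum_smul]
    rw [Finset.sum_eq_single_of_mem 1 (Finset.mem_univ _)]
    · have h5 : Fintype.card (N →* K₀ˣ) = Fintype.card N := by
        simpa using CommGroup.card_monoidHom_of_hasEnoughRootsOfUnity N K₀
      simp [h5]
    · intro h _ hh
      rw [sum_characters_eq_zero hh, zero_smul]
  have h6 : (Fintype.card N : K₀) • v ∈
      Submodule.span K (⋃ χ, (semilinearEigenspace σ s hs (a χ) : Set V)) := by
    rw [← h1]
    exact Submodule.sum_mem _ fun χ _ => Submodule.sum_mem _ fun i _ => Submodule.smul_mem _ _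
      (Submodule.subset_span (Set.mem_iUnion.2 ⟨χ, twistedSum_mem hs (ha χ) _⟩))
  rw [← algebraMap_smul K] at h6
  exact (Submodule.smul_mem_iff_of_isUnit _
    ((card_ne_zero_of_hasEnoughRootsOfUnity (N := N)).isUnit.map (algebraMap K₀ K))).1 h6

/-- Bases over `K₀` of the eigenspaces are jointly independent over `K`: the twisted sum for `χ`
extracts the coefficients at `χ` of a relation, with `k` replaced by its trace. -/
theorem linearIndependent_semilinearEigenspace [Fintype G] [Fintype N]
    (hN : (Fintype.card N : K₀) ≠ 0) (hσ : IsGaloisModulo σ j)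
    (hs : ∀ g (k : K) (v : V), s g (k • v) = σ g k • s g v)
    {a : (N →* K₀ˣ) → G → Kˣ} (ha : ∀ χ, IsExtensionOf σ j χ (a χ))
    {ι : (N →* K₀ˣ) → Type*} {b : ∀ χ, ι χ → semilinearEigenspace σ s hs (a χ)}
    (hb : ∀ χ, LinearIndependent K₀ (b χ)) :
    LinearIndependent K fun i : Σ χ, ι χ => (b i.1 i.2 : V) := by
  classical
  rw [linearIndependent_iff']
  intro S k hk ⟨χ, i⟩ hi
  refine hσ.eq_zero_of_sum_eq_zero hN fun y => ?_
  choose t ht using fun k => hσ.exists_algebraMap_eq_sum k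
  have h1 : ∑ p ∈ S.preimage (Sigma.mk χ) sigma_mk_injective.injOn,
      t (y * k ⟨χ, p⟩) • (b χ p : V) = 0 := by
    have h2 : ∑ p ∈ S, twistedSum s (a χ) ((y * k p) • (b p.1 p.2 : V)) = 0 := by
      simp_rw [mul_smul]
      rw [← map_sum, ← Finset.smul_sum, hk, smul_zero, map_zero]
    rw [← h2, Finset.sum_preimage' (Sigma.mk χ) S sigma_mk_injective.injOn
      (fun p : Σ χ, ι χ => t (y * k p) • (b p.1 p.2 : V)), Finset.sum_filter]
    refine Finset.sum_congr rfl ?_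
    rintro ⟨ψ, p⟩ _
    rw [twistedSum_smul hs (b ψ p).2]
    split_ifs with h3
    · obtain ⟨q, hq⟩ := h3
      obtain rfl : χ = ψ := congrArg Sigma.fst hq
      simp_rw [Units.inv_mul, one_mul]
      rw [← ht, algebraMap_smul]
    · rw [sum_inv_mul_mul_eq_zero hσ (ha χ) (ha ψ), zero_smul]
      rintro rfl
      exact h3 ⟨p, rfl⟩
  have h4 := linearIndependent_iff'.1 (hb χ) (S.preimage (Sigma.mk χ) sigma_mk_injective.injOn)
    (fun p => t (y * k ⟨χ, p⟩)) (by
      refine Subtype.ext ?_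
      simpa using h1) i (by simpa using hi)
  rw [← ht, h4, map_zero]

/-- The union over `χ` of `K₀`-bases of the eigenspaces is a `K`-basis of `V`, which can be indexed
by `ι` because `K` is commutative and nonzero. -/
theorem exists_basis_semilinearEigenspace [Nontrivial K] [Finite G] [Finite N]
    [HasEnoughRootsOfUnity K₀ (Monoid.exponent N)] (hσ : IsGaloisModulo σ j)
    (hs : ∀ g (k : K) (v : V), s g (k • v) = σ g k • s g v)
    {a : (N →* K₀ˣ) → G → Kˣ} (ha : ∀ χ, IsExtensionOf σ j χ (a χ))
    {ι : Type*} (e : Module.Basis ι K V) :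
    ∃ (χ : ι → N →* K₀ˣ) (b : Module.Basis ι K V),
      ∀ i g, s g (b i) = (a (χ i) g : K) • b i := by
  have := Fintype.ofFinite G
  have := Fintype.ofFinite N
  let B := fun χ => Module.Basis.ofVectorSpace K₀ (semilinearEigenspace σ s hs (a χ))
  let b := Module.Basis.mk (linearIndependent_semilinearEigenspace
    card_ne_zero_of_hasEnoughRootsOfUnity hσ hs ha fun χ => (B χ).linearIndependent) (by
      rw [← span_semilinearEigenspace hσ hs ha, Submodule.span_le, Set.iUnion_subset_iff]
      intro χ v hv
      have h1 : (⟨v, hv⟩ : semilinearEigenspace σ s hs (a χ)) ∈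
          Submodule.span K₀ (Set.range (B χ)) := (B χ).span_eq ▸ Submodule.mem_top
      have h2 := Submodule.mem_map_of_mem (f := (semilinearEigenspace σ s hs (a χ)).subtype) h1
      rw [Submodule.map_span] at h2
      refine Submodule.span_subset_span K₀ K _ (Submodule.span_mono ?_ h2)
      rintro _ ⟨_, ⟨p, rfl⟩, rfl⟩
      exact ⟨⟨χ, p⟩, rfl⟩)
  let f := b.indexEquiv e
  refine ⟨fun i => (f.symm i).1, b.reindex f, fun i g => ?_⟩
  rw [Module.Basis.reindex_apply, Module.Basis.mk_apply]
  exact (B _ _).2 g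

end Descent

/-! ### Diagonal and permutation matrices -/

section DiagonalMatrices

variable {n : ℕ} {R S : Type*} [CommRing R] [CommRing S]

/-- The invertible diagonal matrix with given diagonal entries. -/
def diagonalGL (n : ℕ) (R : Type*) [CommRing R] : (Fin n → Rˣ) →* GL (Fin n) R :=
  (Units.map (Matrix.diagonalRingHom (Fin n) R : (Fin n → R) →* Matrix (Fin n) (Fin n) R)).comp
    MulEquiv.piUnits.symm.toMonoidHom

@[simp]
theorem coe_diagonalGL (d : Fin n → Rˣ) :
    (diagonalGL n R d : Matrix (Fin n) (Fin n) R) = Matrix.diagonal fun i => (d i : R) := rfl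

/-- The invertible matrix of a permutation. -/
def permGL (n : ℕ) (R : Type*) [CommRing R] : Equiv.Perm (Fin n) →* GL (Fin n) R :=
  (Units.map Matrix.permMatrixHom).comp (toUnits : Equiv.Perm (Fin n) ≃* _).toMonoidHom

theorem coe_permGL (τ : Equiv.Perm (Fin n)) :
    (permGL n R τ : Matrix (Fin n) (Fin n) R) = τ⁻¹.permMatrix R := rfl

theorem diagonalGL_mul_permGL (d : Fin n → Rˣ) (τ : Equiv.Perm (Fin n)) :
    diagonalGL n R d * permGL n R τ = permGL n R τ * diagonalGL n R (d ∘ τ) := by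
  ext i k
  simp only [Units.val_mul, coe_diagonalGL, coe_permGL, Matrix.diagonal_mul, Matrix.mul_diagonal,
    Equiv.Perm.permMatrix, PEquiv.toMatrix_apply, Equiv.toPEquiv_apply, Option.mem_def,
    Option.some_inj, Function.comp_apply]
  split_ifs with h
  · simp [← h]
  · simp

theorem coe_glAut (τ : RingAut R) (A : GL (Fin n) R) :
    (glAut n R τ A : Matrix (Fin n) (Fin n) R) = (A : Matrix (Fin n) (Fin n) R).map τ := rfl

theorem glAut_permGL (τ : RingAut R) (p : Equiv.Perm (Fin n)) :
    glAut n R τ (permGL n R p) = permGL n R p := by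
  ext i k
  simp only [coe_glAut, coe_permGL, Matrix.map_apply, Equiv.Perm.permMatrix, PEquiv.toMatrix_apply]
  split_ifs <;> simp

theorem glAut_diagonalGL (τ : RingAut R) (d : Fin n → Rˣ) :
    glAut n R τ (diagonalGL n R d) = diagonalGL n R fun i => unitsAut R τ (d i) := by
  ext i k
  rw [coe_glAut, coe_diagonalGL, Matrix.diagonal_map (map_zero τ)]
  rfl

theorem map_diagonalGL (f : R →+* S) (d : Fin n → Rˣ) :
    Matrix.GeneralLinearGroup.map f (diagonalGL n R d) =
      diagonalGL n S fun i => Units.map (f : R →* S) (d i) := by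
  ext i k
  change (Matrix.diagonal fun i => (d i : R)).map f i k = _
  rw [Matrix.diagonal_map (map_zero f)]
  rfl

/-- If diagonal representations over a field become conjugate in a nonzero algebra, then their
characters agree up to a permutation: some term of the Leibniz formula for the determinant of the
conjugating matrix is nonzero. -/
theorem exists_perm_of_diagonalGL_conj {N K₀ K : Type*} [Field K₀] [CommRing K] [Nontrivial K]
    [Algebra K₀ K] {χ ψ : Fin n → N → K₀ˣ} (P : GL (Fin n) K)
    (hP : ∀ h, diagonalGL n K (fun i => Units.map (algebraMap K₀ K : K₀ →* K) (χ i h)) * P =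
      P * diagonalGL n K (fun i => Units.map (algebraMap K₀ K : K₀ →* K) (ψ i h))) :
    ∃ τ : Equiv.Perm (Fin n), ψ = χ ∘ τ := by
  obtain ⟨τ, hτ⟩ : ∃ τ : Equiv.Perm (Fin n), ∏ i, (P : Matrix (Fin n) (Fin n) K) (τ i) i ≠ 0 := by
    by_contra! h
    have h1 : (P : Matrix (Fin n) (Fin n) K).det = 0 := by
      rw [Matrix.det_apply]
      exact Finset.sum_eq_zero fun τ _ => by rw [h τ, smul_zero]
    exact (Matrix.GeneralLinearGroup.det P).ne_zero h1
  refine ⟨τ, funext fun i => funext fun h => ?_⟩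
  have h1 : (P : Matrix (Fin n) (Fin n) K) (τ i) i ≠ 0 := fun h0 =>
    hτ (Finset.prod_eq_zero (Finset.mem_univ i) h0)
  have h2 := congrArg
    (fun A : GL (Fin n) K => (A : Matrix (Fin n) (Fin n) K) (τ i) i) (hP h)
  simp only [Units.val_mul, coe_diagonalGL, Matrix.diagonal_mul, Matrix.mul_diagonal,
    Units.coe_map, MonoidHom.coe_coe] at h2
  have h3 : algebraMap K₀ K (χ (τ i) h - ψ i h) * (P : Matrix (Fin n) (Fin n) K) (τ i) i = 0 := by
    rw [map_sub, sub_mul, h2, mul_comm, sub_self]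
  by_contra hne
  have h4 : (χ (τ i) h - ψ i h : K₀) ≠ 0 := by
    rw [sub_ne_zero]
    exact fun h0 => hne (Units.ext h0.symm)
  exact h1 (((h4.isUnit.map (algebraMap K₀ K)).mul_right_eq_zero).1 h3)

end DiagonalMatrices

/-! ### Diagonalization of cocycles -/

section Diagonalization

variable {G N K₀ K : Type*} [Group G] [CommGroup N] [Field K₀] [CommRing K] [Algebra K₀ K]

/-- The semilinear action `v ↦ c(g) · ᵍv` of `G` on `Kⁿ` defined by a cocycle `c`. -/
def cocycleAction {n : ℕ} (σ : G →* (K ≃ₐ[K₀] K)) (c : G → GL (Fin n) K)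
    (hc : ∀ g g', c (g * g') = c g * glAut n K (σ g : K ≃+* K) (c g')) :
    G →* AddMonoid.End (Fin n → K) where
  toFun g := (Matrix.mulVecLin (c g : Matrix (Fin n) (Fin n) K)).toAddMonoidHom.comp
    ((σ g : K →+* K).toAddMonoidHom.compLeft (Fin n))
  map_one' := by
    have h1 : c 1 = 1 := by
      have h := hc 1 1
      rw [mul_one, map_one] at h
      have h2 : glAut n K ((1 : K ≃ₐ[K₀] K) : K ≃+* K) (c 1) = c 1 := rfl
      rw [h2] at h
      exact left_eq_mul.1 h
    refine AddMonoidHom.ext fun v => ?_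
    change (c 1 : Matrix (Fin n) (Fin n) K).mulVec (fun i => σ 1 (v i)) = v
    rw [h1, map_one, Units.val_one, Matrix.one_mulVec]
    rfl
  map_mul' g g' := by
    refine AddMonoidHom.ext fun v => ?_
    change (c (g * g') : Matrix (Fin n) (Fin n) K).mulVec (fun i => σ (g * g') (v i)) =
      (c g : Matrix (Fin n) (Fin n) K).mulVec fun i =>
        σ g ((c g' : Matrix (Fin n) (Fin n) K).mulVec (fun k => σ g' (v k)) i)
    rw [hc, Units.val_mul, ← Matrix.mulVec_mulVec, map_mul]
    congr 1
    ext i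
    exact (RingHom.map_mulVec (σ g : K →+* K) _ _ i).symm

theorem cocycleAction_apply {n : ℕ} (σ : G →* (K ≃ₐ[K₀] K)) (c : G → GL (Fin n) K)
    (hc : ∀ g g', c (g * g') = c g * glAut n K (σ g : K ≃+* K) (c g')) (g : G) (v : Fin n → K) :
    cocycleAction σ c hc g v = (c g : Matrix (Fin n) (Fin n) K).mulVec fun i => σ g (v i) := rfl

/-- Every cocycle of `G` in `GL_n(K)` is cohomologous to a diagonal one: take a basis of `Kⁿ`
consisting of eigenvectors of the semilinear action. -/
theorem exists_diagonalGL_eq [Nontrivial K] [Finite G] [Finite N]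
    [HasEnoughRootsOfUnity K₀ (Monoid.exponent N)] {σ : G →* (K ≃ₐ[K₀] K)} {j : N →* G}
    (hσ : IsGaloisModulo σ j)
    {a : (N →* K₀ˣ) → G → Kˣ} (ha : ∀ χ, IsExtensionOf σ j χ (a χ)) {n : ℕ}
    (c : G → GL (Fin n) K)
    (hc : ∀ g g', c (g * g') = c g * glAut n K (σ g : K ≃+* K) (c g')) :
    ∃ (χ : Fin n → N →* K₀ˣ) (P : GL (Fin n) K),
      ∀ g, diagonalGL n K (fun i => a (χ i) g) = P⁻¹ * c g * glAut n K (σ g : K ≃+* K) P := by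
  have hs : ∀ g (k : K) (v : Fin n → K),
      cocycleAction σ c hc g (k • v) = σ g k • cocycleAction σ c hc g v := by
    intro g k v
    simp only [cocycleAction_apply, ← Matrix.mulVec_smul]
    congr 1
    ext i
    simp
  obtain ⟨χ, b, hb⟩ := exists_basis_semilinearEigenspace hσ hs ha (Pi.basisFun K (Fin n))
  let P : GL (Fin n) K := ⟨(Pi.basisFun K (Fin n)).toMatrix b, b.toMatrix (Pi.basisFun K (Fin n)),
    Module.Basis.toMatrix_mul_toMatrix_flip _ _, Module.Basis.toMatrix_mul_toMatrix_flip _ _⟩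
  have hP : ∀ i k, (P : Matrix (Fin n) (Fin n) K) i k = b k i := fun i k => by
    simp [P, Module.Basis.toMatrix_apply]
  refine ⟨χ, P, fun g => ?_⟩
  rw [mul_assoc, eq_inv_mul_iff_mul_eq]
  ext i k
  have h1 := congrFun (hb k g) i
  rw [Units.val_mul, Units.val_mul, coe_diagonalGL, Matrix.mul_diagonal, hP, mul_comm, coe_glAut]
  refine h1.symm.trans ?_
  rw [cocycleAction_apply, Matrix.mulVec, Matrix.mul_apply, dotProduct]
  simp only [Matrix.map_apply, hP]
  rfl

end Diagonalization

/-! ### Classes of diagonal cocycles -/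

section Classes

/-- The class of a cocycle. -/
def NonabH1.mk {G A : Type*} [Group G] [Group A] {ρ : G →* MulAut A} (c : OneCocycle ρ) :
    NonabH1 ρ :=
  Quotient.mk (OneCocycle.setoid ρ) c

theorem NonabH1.mk_eq_mk {G A : Type*} [Group G] [Group A] {ρ : G →* MulAut A}
    {c c' : OneCocycle ρ} (a : A) (ha : ∀ g, c'.toFun g = a⁻¹ * c.toFun g * ρ g a) :
    NonabH1.mk c = NonabH1.mk c' :=
  Quotient.sound ⟨a, ha⟩

/-- A family of cocycles in `Rˣ`, placed on the diagonal. -/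
def OneCocycle.diagonal {G R : Type*} [Group G] [CommRing R] {ρ : G →* RingAut R} {n : ℕ}
    (u : Fin n → OneCocycle ((unitsAut R).comp ρ)) : OneCocycle ((glAut n R).comp ρ) where
  toFun g := diagonalGL n R fun i => (u i).toFun g
  map_mul' g g' := by
    rw [MonoidHom.comp_apply, glAut_diagonalGL, ← map_mul]
    exact congrArg _ (funext fun i => (u i).map_mul' g g')

/-- A family of characters of `N`, as a diagonal cocycle for the trivial action. -/
def OneCocycle.diagonalHom {N R : Type*} [Group N] [CommRing R] {n : ℕ} (χ : Fin n → N →* Rˣ) :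
    OneCocycle (1 : N →* MulAut (GL (Fin n) R)) where
  toFun h := diagonalGL n R fun i => χ i h
  map_mul' h h' := by
    rw [MonoidHom.one_apply, MulAut.one_apply, ← map_mul]
    exact congrArg _ (funext fun i => map_mul (χ i) h h')

theorem NonabH1.mk_diagonal_comp_perm {G R : Type*} [Group G] [CommRing R] {ρ : G →* RingAut R}
    {n : ℕ} (u : Fin n → OneCocycle ((unitsAut R).comp ρ)) (τ : Equiv.Perm (Fin n)) :
    NonabH1.mk (OneCocycle.diagonal (u ∘ τ)) = NonabH1.mk (OneCocycle.diagonal u) := by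
  refine (NonabH1.mk_eq_mk (permGL n R τ) fun g => ?_).symm
  rw [MonoidHom.comp_apply, glAut_permGL, mul_assoc, eq_inv_mul_iff_mul_eq]
  exact (diagonalGL_mul_permGL (fun i => (u i).toFun g) τ).symm

theorem NonabH1.mk_diagonalHom_comp_perm {N R : Type*} [Group N] [CommRing R] {n : ℕ}
    (χ : Fin n → N →* Rˣ) (τ : Equiv.Perm (Fin n)) :
    NonabH1.mk (OneCocycle.diagonalHom (χ ∘ τ)) = NonabH1.mk (OneCocycle.diagonalHom χ) := by
  refine (NonabH1.mk_eq_mk (permGL n R τ) fun g => ?_).symm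
  rw [MonoidHom.one_apply, MulAut.one_apply, mul_assoc, eq_inv_mul_iff_mul_eq]
  exact (diagonalGL_mul_permGL (fun i => χ i g) τ).symm

/-- Over a field with enough roots of unity, representations of a finite abelian group are
diagonalizable. -/
theorem NonabH1.exists_mk_diagonalHom_eq {N K₀ : Type*} [CommGroup N] [Finite N] [Field K₀]
    [HasEnoughRootsOfUnity K₀ (Monoid.exponent N)] {n : ℕ}
    (y : NonabH1 (1 : N →* MulAut (GL (Fin n) K₀))) :
    ∃ χ : Fin n → N →* K₀ˣ, NonabH1.mk (OneCocycle.diagonalHom χ) = y := by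
  induction y using Quotient.inductionOn with | h c => ?_
  have hσ : IsGaloisModulo (1 : N →* (K₀ ≃ₐ[K₀] K₀)) (MonoidHom.id N) :=
    { injective := Function.injective_id
      map_eq_one := fun _ => rfl
      exists_algebraMap_eq := fun x _ => ⟨x, rfl⟩
      exists_separating := ⟨{(1, 1)}, fun g => ⟨fun _ => by simp, fun hg => (hg ⟨g, rfl⟩).elim⟩⟩ }
  obtain ⟨χ, P, hP⟩ := exists_diagonalGL_eq hσ
    (a := fun χ => χ) (fun χ => ⟨fun g g' => by simp, fun h => rfl⟩) c.toFun c.map_mul'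
  exact ⟨χ, (NonabH1.mk_eq_mk P hP).symm⟩

end Classes

/-! ### Galois algebras and extension of characters -/

section Galois

variable {G : Type*} [CommGroup G] [Finite G] {H : Subgroup G} {K₀ K : Type*} [Field K₀]
  [CommRing K] [Algebra K₀ K] [MulSemiringAction (G ⧸ H) K] [SMulCommClass (G ⧸ H) K₀ K]

/-- The action of `G` on `K` through `G/H`, by `K₀`-algebra automorphisms. -/
def inflAlgAction (H : Subgroup G) (K₀ K : Type*) [Field K₀] [CommRing K] [Algebra K₀ K]
    [MulSemiringAction (G ⧸ H) K] [SMulCommClass (G ⧸ H) K₀ K] : G →* (K ≃ₐ[K₀] K) :=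
  (MulSemiringAction.toAlgAut (G ⧸ H) K₀ K).comp (QuotientGroup.mk' H)

/-- The separating elements are the terms of a preimage, in `K ⊗ K`, of the indicator function of
`1 ∈ G/H`. -/
theorem IsGaloisAlgebra.isGaloisModulo (hK : IsGaloisAlgebra K₀ K (G ⧸ H)) :
    IsGaloisModulo (inflAlgAction H K₀ K) H.subtype where
  injective := H.subtype_injective
  map_eq_one h := by
    have h1 : (QuotientGroup.mk' H) (h : G) = 1 := (QuotientGroup.eq_one_iff (h : G)).2 h.2
    rw [inflAlgAction, MonoidHom.comp_apply, H.subtype_apply, h1, map_one]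
  exists_algebraMap_eq x hx := hK.exists_algebraMap_eq fun γ => by
    obtain ⟨g, rfl⟩ := QuotientGroup.mk_surjective γ
    exact hx g
  exists_separating := by
    classical
    obtain ⟨z, hz⟩ := hK.bijective.2 (Pi.single 1 1)
    obtain ⟨S, rfl⟩ := TensorProduct.exists_finset z
    refine ⟨S, fun g => ?_⟩
    have h1 : ∑ p ∈ S, p.1 * inflAlgAction H K₀ K g p.2 =
        (Pi.single 1 1 : G ⧸ H → K) (g : G ⧸ H) := by
      rw [← hz, map_sum, Finset.sum_apply]
      rfl
    rw [h1, H.coe_subtype, show Set.range ((↑) : H → G) = H from Subtype.range_coe]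
    constructor
    · intro hg
      rw [(QuotientGroup.eq_one_iff g).2 hg, Pi.single_eq_same]
    · intro hg
      exact Pi.single_eq_of_ne (fun h => hg ((QuotientGroup.eq_one_iff g).1 h)) 1

/-- Surjectivity of the Hochschild–Serre homomorphism extends every character of `H` to a cocycle of
`G`, on the nose, since coboundaries of `H` in `Kˣ` are trivial. -/
theorem exists_oneCocycle_restrict_eq (hK : IsGaloisAlgebra K₀ K (G ⧸ H))
    (hsurj : Function.Surjective (hochschildSerreMap hK)) (χ : H →* K₀ˣ) :
    ∃ c : OneCocycle (unitsAction H K),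
      ∀ h : H, c.toFun h = Units.map (algebraMap K₀ K : K₀ →* K) (χ h) := by
  obtain ⟨x, hx⟩ := hsurj (Quotient.mk _ ⟨χ, fun h h' => map_mul χ h h'⟩)
  have h1 := (existsUnique_extScalarsUnits_eq_res hK x).choose_spec.1
  change extScalarsUnits H K K₀ (hochschildSerreMap hK x) = _ at h1
  rw [hx] at h1
  induction x using Quotient.inductionOn with | h c => ?_
  obtain ⟨a, ha⟩ := Quotient.exact h1
  refine ⟨c, fun h => ?_⟩
  have h2 : c.toFun h = a⁻¹ * Units.map (algebraMap K₀ K : K₀ →* K) (χ h) *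
      unitsAction H K h a := ha h
  have h3 : unitsAction H K (h : G) = 1 := by simp [unitsAction, inflAction_eq_one]
  rw [h2, h3, MulAut.one_apply, mul_comm, mul_inv_cancel_left]

end Galois

/-! ### The comparison of cohomology sets -/

theorem propositionA2 {G : Type*} [CommGroup G] [Finite G] (H : Subgroup G)
    {K₀ K : Type*} [Field K₀] [CommRing K] [Algebra K₀ K]
    [MulSemiringAction (G ⧸ H) K] [SMulCommClass (G ⧸ H) K₀ K]
    (hζ : ∃ ζ : K₀, IsPrimitiveRoot ζ (Monoid.exponent H))
    (hK : IsGaloisAlgebra K₀ K (G ⧸ H))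
    (hsurj : Function.Surjective (hochschildSerreMap hK))
    (n : ℕ) (hn : 0 < n) :
    ∃! Φ : NonabH1 (glAction H K n) → NonabH1 (1 : H →* MulAut (GL (Fin n) K₀)),
      Function.Bijective Φ ∧
        ∀ x : NonabH1 (glAction H K n),
          extScalarsGL H K K₀ n (Φ x) = NonabH1.res (glAction H K n) H x := by
  have := hK.nontrivial
  have : HasEnoughRootsOfUnity K₀ (Monoid.exponent H) := ⟨hζ, inferInstance⟩
  choose A hA using exists_oneCocycle_restrict_eq hK hsurj
  let DK : (Fin n → H →* K₀ˣ) → NonabH1 (glAction H K n) := fun χ =>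
    NonabH1.mk (OneCocycle.diagonal fun i => A (χ i))
  let D₀ : (Fin n → H →* K₀ˣ) → NonabH1 (1 : H →* MulAut (GL (Fin n) K₀)) := fun χ =>
    NonabH1.mk (OneCocycle.diagonalHom χ)
  have hDK : Function.Surjective DK := by
    intro x
    induction x using Quotient.inductionOn with | h c => ?_
    obtain ⟨χ, P, hP⟩ := exists_diagonalGL_eq hK.isGaloisModulo (a := fun χ => (A χ).toFun)
      (fun χ => ⟨fun g g' => congrArg Units.val ((A χ).map_mul' g g'),
        fun h => congrArg Units.val (hA χ h)⟩) c.toFun c.map_mul'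
    exact ⟨χ, (NonabH1.mk_eq_mk P hP).symm⟩
  have hD₀ : Function.Surjective D₀ := NonabH1.exists_mk_diagonalHom_eq
  have hext : ∀ χ, extScalarsGL H K K₀ n (D₀ χ) = NonabH1.res (glAction H K n) H (DK χ) := by
    intro χ
    refine Quotient.sound ⟨1, fun h => ?_⟩
    rw [map_one, inv_one, one_mul, mul_one]
    change diagonalGL n K (fun i => (A (χ i)).toFun h) =
      Matrix.GeneralLinearGroup.map (algebraMap K₀ K) (diagonalGL n K₀ fun i => χ i h)
    rw [map_diagonalGL]
    simp_rw [hA]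
  -- With `hinj` below: the fibres of `D₀`, also after extension of scalars, are permutation orbits.
  have hperm : ∀ χ ψ, extScalarsGL H K K₀ n (D₀ χ) = extScalarsGL H K K₀ n (D₀ ψ) →
      ∃ τ : Equiv.Perm (Fin n), ψ = χ ∘ τ := by
    intro χ ψ h
    obtain ⟨P, hP⟩ := Quotient.exact h
    obtain ⟨τ, hτ⟩ := exists_perm_of_diagonalGL_conj (χ := fun i h => χ i h)
      (ψ := fun i h => ψ i h) P fun h => by
        have h1 : glAction H K n (h : G) = 1 := by simp [glAction, inflAction_eq_one]
        have h2 : Matrix.GeneralLinearGroup.map (algebraMap K₀ K) (diagonalGL n K₀ fun i => ψ i h) =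
          P⁻¹ * Matrix.GeneralLinearGroup.map (algebraMap K₀ K) (diagonalGL n K₀ fun i => χ i h) *
            glAction H K n (h : G) P := hP h
        rw [h1, MulAut.one_apply, map_diagonalGL, map_diagonalGL, mul_assoc] at h2
        exact (eq_inv_mul_iff_mul_eq.1 h2).symm
    exact ⟨τ, funext fun i => DFunLike.coe_injective (congrFun hτ i)⟩
  have hinj : Function.Injective (extScalarsGL H K K₀ n) := by
    intro y z h
    obtain ⟨χ, rfl⟩ := hD₀ y
    obtain ⟨ψ, rfl⟩ := hD₀ z
    obtain ⟨τ, rfl⟩ := hperm χ ψ h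
    exact (NonabH1.mk_diagonalHom_comp_perm χ τ).symm
  choose φ hφ using hDK
  have hΦ : ∀ x, extScalarsGL H K K₀ n (D₀ (φ x)) = NonabH1.res (glAction H K n) H x := fun x => by
    rw [hext, hφ]
  refine ⟨fun x => D₀ (φ x), ⟨⟨?_, ?_⟩, hΦ⟩, ?_⟩
  · intro x y hxy
    obtain ⟨τ, hτ⟩ := hperm (φ x) (φ y) (congrArg _ hxy)
    rw [← hφ x, ← hφ y, hτ]
    exact (NonabH1.mk_diagonal_comp_perm (fun i => A (φ x i)) τ).symm
  · intro y
    obtain ⟨χ, rfl⟩ := hD₀ y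
    exact ⟨DK χ, hinj (by rw [hΦ, hext])⟩
  · rintro Ψ ⟨-, hΨ⟩
    exact funext fun x => hinj ((hΨ x).trans (hΦ x).symm)
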